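/- **Setup.** A server holds $L$ levels of files; level $i$ has $N_i\ge 1$ files, each of $F$ bits, all files being independent and uniformly distributed. There are $K$ caches, arranged cyclically. For every level $i$ and every cache $k$ there are $U_i$ users who access the $d_i$ cyclically consecutive caches $k,k+1,\dots,k+d_i-1$ and each of whom requests one file of level $i$. A strategy for memory $M$, rate $R$ and file size $F$ first fills each cache with a function of the files taking at most $2^{MF}$ values, without knowing the requests; then, given the vector $r$ of requests, the server broadcasts a function of the files taking at most $2^{RF}$ values; finally every user estimates the requested file from $r$, the broadcast, and the contents of the caches it accesses. (The strategy may be randomized, with randomness that is independent of the files and known to the server and to all users.) The pair $(R,M)$ is achievable if there are strategies, one for each $F$, such that the maximum over all request vectors of the probability that some user fails to recover its file tends to $0$ as $F\to\infty$. Let $$R^\ast(M)=\inf\{R : (R,M)\text{ is achievable}\}.$$ **Lemma.** Let $b\ge 1$ be an integer and $t\in\{1,\dots,K\}$. For every level $i$ let $s_i\ge 1$ be an integer such that $d_i\le s_it\le\lfloor K/2\rfloor$. Then, for every memory $M\ge 0$, $$R^\ast(M)\ \ge\ \sum_{i=1}^{L}\lambda_i\cdot\min\left\{(s_it-d_i+1)U_i\,,\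 \frac{N_i}{s_ib}\right\}-\frac tb\,M,$$ where $\lambda_i=1$ if $s_it=d_i$ and $\lambda_i=\frac12$ if $s_it>d_i$. -/

import Mathlib

open scoped ENNReal Topology

namespace MultiLevelCaching

/-- The contents of the server: for each level `i`, `N i` files of `F` bits each. -/
abbrev Library {L : ℕ} (N : Fin L → ℕ) (F : ℕ) : Type :=
  (i : Fin L) → Fin (N i) → Fin F → Bool

/-- The users of the multi-user setup. For every level `i` and every cache `k`, there are `U i`
users, indexed by `Fin (U i)`, who request a level-`i` file and access the `d i` consecutive caches
starting at cache `k`. -/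
abbrev User {L : ℕ} (K : ℕ) (U : Fin L → ℕ) : Type :=
  (i : Fin L) × Fin K × Fin (U i)

/-- A request vector: every level-`i` user asks for one of the `N i` files of level `i`. -/
abbrev Request {L : ℕ} (K : ℕ) (N U : Fin L → ℕ) : Type :=
  (v : User K U) → Fin (N v.1)

/-- The cache reached from cache `k` after `j` steps, with cyclic wrap-around. -/
def cacheAt {K : ℕ} (k : Fin K) (j : ℕ) : Fin K :=
  ⟨(k.val + j) % K, Nat.mod_lt _ k.pos⟩

/-- The possible contents of a memory or message of (real) size `x` bits: at most `2 ^ x` values. -/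
abbrev Content (x : ℝ) : Type := Fin ⌊(2 : ℝ) ^ x⌋₊

/-- A deterministic placement-and-delivery scheme for files of `F` bits, with caches of `M * F`
bits and a broadcast message of `R * F` bits. -/
structure Scheme {L : ℕ} (K : ℕ) (N U d : Fin L → ℕ) (M R : ℝ) (F : ℕ) where
  /-- Placement phase: the content of each cache, chosen before the requests are known. -/
  place : Fin K → Library N F → Content (M * F)
  /-- Delivery phase: the broadcast message, chosen once the requests are known. -/
  broadcast : Request K N U → Library N F → Content (R * F)
  /-- Decoding: each user knows the request vector, the contents of the caches he accesses, and
  the broadcast message. -/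
  decode : Request K N U → (v : User K U) → (Fin (d v.1) → Content (M * F)) → Content (R * F) →
    Fin F → Bool

/-- When the library is `W` and the request vector is `r`, all users recover the files that they
have requested. -/
def Scheme.Succeeds {L K : ℕ} {N U d : Fin L → ℕ} {M R : ℝ} {F : ℕ}
    (σ : Scheme K N U d M R F) (r : Request K N U) (W : Library N F) : Prop :=
  ∀ v : User K U,
    σ.decode r v (fun j => σ.place (cacheAt v.2.1 j) W) (σ.broadcast r W) = W v.1 (r v)

/-- A (possibly randomized) strategy: a probability distribution on deterministic schemes.
The outcome of the randomization is independent of the files and known to the server and to all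
users. -/
abbrev Strategy {L : ℕ} (K : ℕ) (N U d : Fin L → ℕ) (M R : ℝ) (F : ℕ) : Type :=
  PMF (Scheme K N U d M R F)

/-- The probability, for independent and uniformly distributed files, that some user fails to
recover the file requested in `r`. -/
noncomputable def errorProb {L K : ℕ} {N U d : Fin L → ℕ} {M R : ℝ} {F : ℕ}
    (P : Strategy K N U d M R F) (r : Request K N U) : ℝ≥0∞ :=
  ∑' σ, P σ * (PMF.uniformOfFintype (Library N F)).toOuterMeasure {W | ¬ σ.Succeeds r W}

/-- The pair `(R, M)` is achievable: there are strategies, one for each file size `F`, whose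
worst-case (over all request vectors) error probability vanishes as `F` grows. -/
def Achievable {L : ℕ} (K : ℕ) (N U d : Fin L → ℕ) (R M : ℝ) : Prop :=
  ∃ P : (F : ℕ) → Strategy K N U d M R F,
    Filter.Tendsto (fun F => ⨆ r : Request K N U, errorProb (P F) r) Filter.atTop (𝓝 0)

/-- The optimal rate-memory trade-off `R*(M)`. -/
noncomputable def optimalRate {L : ℕ} (K : ℕ) (N U d : Fin L → ℕ) (M : ℝ) : ℝ :=
  sInf {R : ℝ | Achievable K N U d R M}

end MultiLevelCaching

/-! For large F, averaging over the randomization and a union bound over the finitely many request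
vectors give one deterministic scheme that serves every request on at least half of the libraries
(`exists_scheme_of_errorProb_le`). With the library uniform on the good ones, decoding is exact, so
no Fano inequality is needed; the price is one bit: n files have, given any disjoint set of files,
entropy at least nF - 1 bits (`le_jointEntropy_union_sub`).

Attach b broadcasts to each cache p and group them with the t caches from p on. A group has entropy
at most (tM + bR)F bits. Summed over all starting points, the conditional entropy of s successive
groups, divided by s, does not increase with s (`windowEntropy_div_antitone`); this is
submodularity. The levels are handled in order of increasing s_i: s_i groups determine many files of
level i, whose entropy is collected when the whole level joins the conditioning
(`windowEntropy_level_le`), and the window then grows to the next s_i.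

The requests may depend on p but not on the window that p is seen from, and must still make every
window cover many distinct files of every level. `min_le_card_windowFiles` counts them; the factor
1/2 comes from windows that wrap around the numbering of the caches. -/

namespace MultiLevelCaching

/-! ### Shannon entropy of a uniform outcome, and submodularity. -/

section JointEntropy

open scoped Classical in
/-- The outcomes that agree with `ω` in all variables of the family `Y` with index in `S`. -/
noncomputable def agreeSet {Ω ι : Type*} [Fintype Ω] {α : ι → Type*} (Y : (j : ι) → Ω → α j)
    (S : Set ι) (ω : Ω) : Finset Ω :=
  Finset.univ.filter fun ω' => ∀ j ∈ S, Y j ω' = Y j ω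

/-- The joint Shannon entropy (in nats) of the variables of the family `Y` with index in `S`,
for a uniformly distributed outcome. -/
noncomputable def jointEntropy {Ω ι : Type*} [Fintype Ω] {α : ι → Type*} (Y : (j : ι) → Ω → α j)
    (S : Set ι) : ℝ :=
  (∑ ω, (Real.log (Fintype.card Ω) - Real.log (agreeSet Y S ω).card)) / Fintype.card Ω

variable {Ω ι : Type*} [Fintype Ω] {α : ι → Type*} (Y : (j : ι) → Ω → α j)

theorem mem_agreeSet {S : Set ι} {ω ω' : Ω} :
    ω' ∈ agreeSet Y S ω ↔ ∀ j ∈ S, Y j ω' = Y j ω := by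
  simp [agreeSet]

theorem self_mem_agreeSet (S : Set ι) (ω : Ω) : ω ∈ agreeSet Y S ω := by
  simp [mem_agreeSet]

theorem agreeSet_eq_of_mem {S : Set ι} {ω ω' : Ω} (h : ω' ∈ agreeSet Y S ω) :
    agreeSet Y S ω' = agreeSet Y S ω := by
  ext x
  rw [mem_agreeSet] at h
  simp only [mem_agreeSet]
  exact forall₂_congr fun j hj => by rw [h j hj]

theorem agreeSet_card_pos (S : Set ι) (ω : Ω) : (0 : ℝ) < (agreeSet Y S ω).card :=
  Nat.cast_pos.2 (Finset.card_pos.2 ⟨ω, self_mem_agreeSet Y S ω⟩)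

theorem jointEntropy_le_of_determines {A B : Set ι}
    (h : ∀ ω ω', (∀ j ∈ A, Y j ω' = Y j ω) → ∀ j ∈ B, Y j ω' = Y j ω) :
    jointEntropy Y B ≤ jointEntropy Y A := by
  unfold jointEntropy
  refine div_le_div_of_nonneg_right (Finset.sum_le_sum fun ω _ => ?_) (Nat.cast_nonneg _)
  refine sub_le_sub_left (Real.log_le_log (agreeSet_card_pos Y A ω) ?_) _
  refine Nat.cast_le.2 (Finset.card_le_card fun ω' hω' => ?_)
  rw [mem_agreeSet] at hω' ⊢
  exact h ω ω' hω'

theorem jointEntropy_mono {A B : Set ι} (h : A ⊆ B) : jointEntropy Y A ≤ jointEntropy Y B :=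
  jointEntropy_le_of_determines Y fun _ _ hB j hj => hB j (h hj)

theorem jointEntropy_empty : jointEntropy Y ∅ = 0 := by
  simp [jointEntropy, agreeSet]

theorem jointEntropy_eq_log_card [Nonempty Ω] {S : Set ι}
    (h : ∀ ω ω', (∀ j ∈ S, Y j ω' = Y j ω) → ω' = ω) :
    jointEntropy Y S = Real.log (Fintype.card Ω) := by
  have h1 : ∀ ω, agreeSet Y S ω = {ω} := by
    intro ω
    ext x
    rw [mem_agreeSet, Finset.mem_singleton]
    exact ⟨h ω x, by rintro rfl; simp⟩
  simp [jointEntropy, h1]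

/-- The agreement sets are the classes of an equivalence relation, so all summands equal the inverse
of the size of one class. -/
theorem sum_inv_card_agreeSet (S : Set ι) (ω : Ω) :
    ∑ x ∈ agreeSet Y S ω, ((agreeSet Y S x).card : ℝ)⁻¹ = 1 := by
  rw [Finset.sum_congr rfl fun x hx => by rw [agreeSet_eq_of_mem Y hx], Finset.sum_const,
    nsmul_eq_mul]
  exact mul_inv_cancel₀ (agreeSet_card_pos Y S ω).ne'

theorem jointEntropy_singleton_le [Nonempty Ω] (j : ι) [Fintype (α j)] :
    jointEntropy Y {j} ≤ Real.log (Fintype.card (α j)) := by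
  classical
  have hΩ : (0 : ℝ) < Fintype.card Ω := Nat.cast_pos.2 Fintype.card_pos
  have : Nonempty (α j) := ⟨Y j (Classical.arbitrary Ω)⟩
  have hα : (0 : ℝ) < Fintype.card (α j) := Nat.cast_pos.2 Fintype.card_pos
  have hsum : ∑ ω, ((agreeSet Y {j} ω).card : ℝ)⁻¹ ≤ Fintype.card (α j) := by
    rw [← Finset.sum_fiberwise Finset.univ (Y j), ← Finset.card_univ, Finset.cast_card]
    refine Finset.sum_le_sum fun a _ => ?_
    rcases (Finset.univ.filter fun ω => Y j ω = a).eq_empty_or_nonempty with h | ⟨ω, hω⟩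
    · rw [h]; simp
    · have : (Finset.univ.filter fun ω => Y j ω = a) = agreeSet Y {j} ω := by
        ext x
        simp [mem_agreeSet, (Finset.mem_filter.1 hω).2]
      rw [this, sum_inv_card_agreeSet]
  unfold jointEntropy
  rw [div_le_iff₀ hΩ]
  calc ∑ ω, (Real.log (Fintype.card Ω) - Real.log (agreeSet Y {j} ω).card)
      ≤ ∑ ω, (Real.log (Fintype.card (α j)) + (Fintype.card Ω / Fintype.card (α j) *
          ((agreeSet Y {j} ω).card : ℝ)⁻¹ - 1)) := by
        refine Finset.sum_le_sum fun ω _ => ?_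
        have hn := agreeSet_card_pos Y {j} ω
        -- Gibbs' inequality against the uniform law on `α j`. The sum of inverse class sizes counts
        -- the values attained.
        have := Real.log_le_sub_one_of_pos (mul_pos (div_pos hΩ hα) (inv_pos.2 hn))
        rw [Real.log_mul (div_pos hΩ hα).ne' (inv_pos.2 hn).ne', Real.log_div hΩ.ne' hα.ne',
          Real.log_inv] at this
        linarith
    _ = Real.log (Fintype.card (α j)) * Fintype.card Ω + (Fintype.card Ω / Fintype.card (α j) *
          ∑ ω, ((agreeSet Y {j} ω).card : ℝ)⁻¹ - Fintype.card Ω) := by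
        rw [Finset.sum_add_distrib, Finset.sum_sub_distrib, ← Finset.mul_sum]
        simp [mul_comm]
    _ ≤ _ := by
        have := mul_le_mul_of_nonneg_left hsum (div_pos hΩ hα).le
        rw [div_mul_cancel₀ _ hα.ne'] at this
        linarith

/-- Write the product of sizes as a count of pairs (x, y) and sum over ω first. The ω compatible
with a given pair are empty or one class for A ∪ B, on which the first weights sum to 1; if
nonempty, x and y agree on A ∩ B. The second weights then sum to 1 over y. -/
theorem sum_card_mul_card_le (A B : Set ι) :
    ∑ ω, ((agreeSet Y A ω).card * (agreeSet Y B ω).card : ℝ) *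
      (((agreeSet Y (A ∪ B) ω).card : ℝ)⁻¹ * ((agreeSet Y (A ∩ B) ω).card : ℝ)⁻¹)
      ≤ Fintype.card Ω := by
  classical
  set u : Ω → ℝ := fun ω => ((agreeSet Y (A ∪ B) ω).card : ℝ)⁻¹ with hu
  set v : Ω → ℝ := fun ω => ((agreeSet Y (A ∩ B) ω).card : ℝ)⁻¹ with hv
  have hv0 : ∀ ω, 0 ≤ v ω := fun ω => inv_nonneg.2 (Nat.cast_nonneg _)
  calc ∑ ω, ((agreeSet Y A ω).card * (agreeSet Y B ω).card : ℝ) * (u ω * v ω)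
      = ∑ ω, ∑ x, ∑ y, if x ∈ agreeSet Y A ω ∧ y ∈ agreeSet Y B ω then u ω * v ω else 0 := by
        refine Finset.sum_congr rfl fun ω _ => ?_
        simp only [ite_and, Finset.sum_ite_mem, Finset.univ_inter, Finset.sum_const,
          Finset.sum_ite_irrel, smul_zero, nsmul_eq_mul, mul_assoc]
    _ = ∑ x, ∑ y, ∑ ω, if x ∈ agreeSet Y A ω ∧ y ∈ agreeSet Y B ω then u ω * v ω else 0 := by
        rw [Finset.sum_comm]
        exact Finset.sum_congr rfl fun x _ => Finset.sum_comm
    _ ≤ ∑ x, ∑ y, if y ∈ agreeSet Y (A ∩ B) x then v x else 0 := by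
        refine Finset.sum_le_sum fun x _ => Finset.sum_le_sum fun y _ => ?_
        rw [← Finset.sum_filter]
        rcases (Finset.univ.filter fun ω => x ∈ agreeSet Y A ω ∧
          y ∈ agreeSet Y B ω).eq_empty_or_nonempty with h | ⟨ω, hω⟩
        · rw [h, Finset.sum_empty]
          split_ifs
          exacts [hv0 x, le_rfl]
        · obtain ⟨hx, hy⟩ := (Finset.mem_filter.1 hω).2
          have hset : (Finset.univ.filter fun ω => x ∈ agreeSet Y A ω ∧ y ∈ agreeSet Y B ω) =
              agreeSet Y (A ∪ B) ω := by
            ext z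
            simp only [Finset.mem_filter, Finset.mem_univ, true_and, mem_agreeSet,
              Set.mem_union] at hx hy ⊢
            refine ⟨fun h j hj => ?_, fun h => ⟨fun j hj => ?_, fun j hj => ?_⟩⟩
            · rcases hj with hj | hj
              · rw [← h.1 j hj, hx j hj]
              · rw [← h.2 j hj, hy j hj]
            · rw [h j (Or.inl hj), hx j hj]
            · rw [h j (Or.inr hj), hy j hj]
          have hxy : y ∈ agreeSet Y (A ∩ B) x := by
            rw [mem_agreeSet] at hx hy ⊢
            exact fun j hj => (hy j hj.2).trans (hx j hj.1).symm
          rw [hset, if_pos hxy]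
          have hvz : ∀ z ∈ agreeSet Y (A ∪ B) ω, u z * v z = u z * v x := by
            intro z hz
            have : x ∈ agreeSet Y (A ∩ B) z := by
              rw [mem_agreeSet] at hx hz ⊢
              exact fun j hj => (hx j hj.1).trans (hz j (Or.inl hj.1)).symm
            rw [hv]
            simp only
            rw [agreeSet_eq_of_mem Y this]
          rw [Finset.sum_congr rfl hvz, ← Finset.sum_mul, sum_inv_card_agreeSet, one_mul]
    _ = Fintype.card Ω := by
        simp only [Finset.sum_ite_mem, Finset.univ_inter, Finset.sum_const, nsmul_eq_mul]
        rw [Finset.sum_congr rfl fun x _ => mul_inv_cancel₀ (agreeSet_card_pos Y (A ∩ B) x).ne']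
        simp

/-- Submodularity follows from log x ≤ x - 1 applied to the ratio of class sizes, whose mean is at
most 1 by `sum_card_mul_card_le`. -/
theorem jointEntropy_union_add_inter_le [Nonempty Ω] (A B : Set ι) :
    jointEntropy Y (A ∪ B) + jointEntropy Y (A ∩ B) ≤ jointEntropy Y A + jointEntropy Y B := by
  have hΩ : (0 : ℝ) < Fintype.card Ω := Nat.cast_pos.2 Fintype.card_pos
  unfold jointEntropy
  rw [← add_div, ← add_div, ← Finset.sum_add_distrib, ← Finset.sum_add_distrib]
  refine div_le_div_of_nonneg_right ?_ hΩ.le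
  rw [← sub_nonpos, ← Finset.sum_sub_distrib]
  have hle := sum_card_mul_card_le Y A B
  calc _ ≤ ∑ ω, (((agreeSet Y A ω).card * (agreeSet Y B ω).card : ℝ) *
        (((agreeSet Y (A ∪ B) ω).card : ℝ)⁻¹ * ((agreeSet Y (A ∩ B) ω).card : ℝ)⁻¹) - 1) := by
        refine Finset.sum_le_sum fun ω _ => ?_
        have ha := agreeSet_card_pos Y A ω
        have hb := agreeSet_card_pos Y B ω
        have hc := agreeSet_card_pos Y (A ∪ B) ω
        have hd := agreeSet_card_pos Y (A ∩ B) ω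
        have := Real.log_le_sub_one_of_pos (mul_pos (mul_pos ha hb)
          (mul_pos (inv_pos.2 hc) (inv_pos.2 hd)))
        rw [Real.log_mul (mul_pos ha hb).ne' (mul_pos (inv_pos.2 hc) (inv_pos.2 hd)).ne',
          Real.log_mul ha.ne' hb.ne', Real.log_mul (inv_pos.2 hc).ne' (inv_pos.2 hd).ne',
          Real.log_inv, Real.log_inv] at this
        linarith
    _ ≤ 0 := by
        rw [Finset.sum_sub_distrib]
        simpa using hle

theorem jointEntropy_add_le_of_subset [Nonempty Ω] {A B C D : Set ι} (hC : C ⊆ A ∪ B)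
    (hDA : D ⊆ A) (hDB : D ⊆ B) :
    jointEntropy Y C + jointEntropy Y D ≤ jointEntropy Y A + jointEntropy Y B :=
  (add_le_add (jointEntropy_mono Y hC) (jointEntropy_mono Y (Set.subset_inter hDA hDB))).trans
    (jointEntropy_union_add_inter_le Y A B)

theorem jointEntropy_union_le [Nonempty Ω] (A B : Set ι) :
    jointEntropy Y (A ∪ B) ≤ jointEntropy Y A + jointEntropy Y B := by
  have := jointEntropy_add_le_of_subset Y (A := A) (B := B) subset_rfl
    (Set.empty_subset A) (Set.empty_subset B)
  rwa [jointEntropy_empty, add_zero] at this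

theorem jointEntropy_biUnion_le [Nonempty Ω] {β : Type*} (T : Finset β) (A : β → Set ι) :
    jointEntropy Y (⋃ x ∈ T, A x) ≤ ∑ x ∈ T, jointEntropy Y (A x) := by
  classical
  induction T using Finset.induction_on with
  | empty => simp [jointEntropy_empty]
  | insert a T ha ih =>
    rw [Finset.sum_insert ha, Finset.set_biUnion_insert]
    exact (jointEntropy_union_le Y _ _).trans (by linarith)

/-- Conditioning on all variables of `E'`, rather than on those of `E`, costs at least the joint
entropy, given `E`, of the variables of `E'` that are determined by `S`. -/
theorem jointEntropy_sub_le_of_determines [Nonempty Ω] {S D E E' : Set ι} (hE : E ⊆ E')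
    (hD : D ⊆ E') (h : ∀ ω ω', (∀ j ∈ S, Y j ω' = Y j ω) → ∀ j ∈ D, Y j ω' = Y j ω) :
    (jointEntropy Y (E ∪ D) - jointEntropy Y E) + (jointEntropy Y (S ∪ E') - jointEntropy Y E')
      ≤ jointEntropy Y (S ∪ E) - jointEntropy Y E := by
  have h1 : jointEntropy Y (S ∪ E ∪ D) ≤ jointEntropy Y (S ∪ E) := by
    refine jointEntropy_le_of_determines Y fun ω ω' hA j hj => ?_
    rcases hj with hj | hj
    · exact hA j hj
    · exact h ω ω' (fun i hi => hA i (Or.inl hi)) j hj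
  have h2 : jointEntropy Y (S ∪ E') + jointEntropy Y (E ∪ D) ≤
      jointEntropy Y (S ∪ E ∪ D) + jointEntropy Y E' := by
    refine jointEntropy_add_le_of_subset Y ?_ ?_ (Set.union_subset hE hD)
    · exact Set.union_subset (fun x hx => Or.inl (Or.inl (Or.inl hx))) Set.subset_union_right
    · exact Set.union_subset (fun x hx => Or.inl (Or.inr hx)) Set.subset_union_right
  linarith

/-! ### Sliding windows. -/

/-- The joint entropy of the `s` sets `A k, A (f k), …, A (f^[s-1] k)`, given `E`, summed over
all starting points `k`. -/
noncomputable def windowEntropy {κ : Type*} [Fintype κ] (A : κ → Set ι) (f : κ → κ) (E : Set ι)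
    (s : ℕ) : ℝ :=
  ∑ k, (jointEntropy Y ((⋃ j ∈ Finset.range s, A (f^[j] k)) ∪ E) - jointEntropy Y E)

theorem windowEntropy_zero {κ : Type*} [Fintype κ] (A : κ → Set ι) (f : κ → κ) (E : Set ι) :
    windowEntropy Y A f E 0 = 0 := by
  simp [windowEntropy]

theorem windowEntropy_concave [Nonempty Ω] {κ : Type*} [Fintype κ] (A : κ → Set ι) (f : κ ≃ κ)
    (E : Set ι) (s : ℕ) :
    windowEntropy Y A f E (s + 2) + windowEntropy Y A f E s ≤ 2 * windowEntropy Y A f E (s + 1) := by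
  -- As f is a bijection, the sum may start its windows at f k. The windows of length s + 1 at k and
  -- at f k then have the window of length s + 2 at k as union, and share the one of length s at f
  -- k.
  have hshift : ∀ n, windowEntropy Y A f E n = ∑ k,
      (jointEntropy Y ((⋃ j ∈ Finset.range n, A (f^[j] (f k))) ∪ E) - jointEntropy Y E) :=
    fun n => (Equiv.sum_comp f fun k =>
      jointEntropy Y ((⋃ j ∈ Finset.range n, A (f^[j] k)) ∪ E) - jointEntropy Y E).symm
  rw [two_mul]
  rw [hshift s]
  nth_rewrite 2 [hshift (s + 1)]
  unfold windowEntropy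
  rw [← Finset.sum_add_distrib, ← Finset.sum_add_distrib]
  refine Finset.sum_le_sum fun k _ => ?_
  have key : jointEntropy Y ((⋃ j ∈ Finset.range (s + 2), A (f^[j] k)) ∪ E) +
      jointEntropy Y ((⋃ j ∈ Finset.range s, A (f^[j] (f k))) ∪ E) ≤
      jointEntropy Y ((⋃ j ∈ Finset.range (s + 1), A (f^[j] k)) ∪ E) +
      jointEntropy Y ((⋃ j ∈ Finset.range (s + 1), A (f^[j] (f k))) ∪ E) := by
    refine jointEntropy_add_le_of_subset Y ?_ ?_ ?_
    · rintro x (hx | hx)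
      · simp only [Set.mem_iUnion, Finset.mem_range, exists_prop] at hx
        obtain ⟨j, hj, hx⟩ := hx
        rcases j with _ | j
        · refine Or.inl (Or.inl ?_)
          simp only [Set.mem_iUnion, Finset.mem_range, exists_prop]
          exact ⟨0, by omega, hx⟩
        · refine Or.inr (Or.inl ?_)
          simp only [Set.mem_iUnion, Finset.mem_range, exists_prop]
          exact ⟨j, by omega, hx⟩
      · exact Or.inl (Or.inr hx)
    · refine Set.union_subset_union_left _ fun x hx => ?_
      simp only [Set.mem_iUnion, Finset.mem_range, exists_prop] at hx ⊢
      obtain ⟨j, hj, hx⟩ := hx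
      exact ⟨j + 1, by omega, hx⟩
    · refine Set.union_subset_union_left _ fun x hx => ?_
      simp only [Set.mem_iUnion, Finset.mem_range, exists_prop] at hx ⊢
      obtain ⟨j, hj, hx⟩ := hx
      exact ⟨j, by omega, hx⟩
  linarith

theorem mul_succ_le_of_concave {g : ℕ → ℝ} (h0 : g 0 = 0)
    (h : ∀ n, g (n + 2) + g n ≤ 2 * g (n + 1)) (n : ℕ) : n * g (n + 1) ≤ (n + 1) * g n := by
  induction n with
  | zero => simp [h0]
  | succ n ih =>
    have := mul_le_mul_of_nonneg_left (h n) (by positivity : (0 : ℝ) ≤ n + 1)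
    push_cast
    nlinarith

/-- The sliding-window subset entropy inequality. -/
theorem windowEntropy_div_antitone [Nonempty Ω] {κ : Type*} [Fintype κ] (A : κ → Set ι)
    (f : κ ≃ κ) (E : Set ι) {m n : ℕ} (hm : 1 ≤ m) (hmn : m ≤ n) :
    windowEntropy Y A f E n / n ≤ windowEntropy Y A f E m / m := by
  induction n, hmn using Nat.le_induction with
  | base => exact le_rfl
  | succ n hn ih =>
    refine le_trans ?_ ih
    have hn0 : (0 : ℝ) < n := Nat.cast_pos.2 (by omega)
    have := mul_succ_le_of_concave (windowEntropy_zero Y A f E) (windowEntropy_concave Y A f E) n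
    rw [div_le_div_iff₀ (by positivity) hn0]
    push_cast
    linarith

end JointEntropy

/-! ### The requests, and how many files a window covers. -/

section Requests

theorem cacheAt_cacheAt {K : ℕ} (k : Fin K) (m n : ℕ) :
    cacheAt (cacheAt k m) n = cacheAt k (m + n) := by
  simp [cacheAt, add_assoc]

theorem cacheAt_zero {K : ℕ} (k : Fin K) : cacheAt k 0 = k := by
  simp [cacheAt, Nat.mod_eq_of_lt k.isLt]

theorem cacheAt_injective {K : ℕ} (t : ℕ) : Function.Injective fun k : Fin K => cacheAt k t := by
  intro k k' h
  have h1 : k.val + t ≡ k'.val + t [MOD K] := congrArg Fin.val h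
  exact Fin.ext ((Nat.ModEq.add_right_cancel' t h1).eq_of_lt_of_lt k.isLt k'.isLt)

/-- The rotation of the caches by `t` steps. -/
noncomputable def rotate (K t : ℕ) : Fin K ≃ Fin K :=
  Equiv.ofBijective (fun k => cacheAt k t) (Finite.injective_iff_bijective.1 (cacheAt_injective t))

theorem rotate_iterate {K : ℕ} (t j : ℕ) (k : Fin K) :
    (rotate K t)^[j] k = cacheAt k (j * t) := by
  induction j with
  | zero => simp [cacheAt_zero]
  | succ j ih =>
    rw [Function.iterate_succ_apply', ih, Nat.succ_mul, ← cacheAt_cacheAt]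
    rfl

/-- Every cyclic window of `w` positions contains an interval without wrap-around of at least
`w / 2` positions. -/
theorem exists_interval_in_window {K w k : ℕ} (hk : k < K) (hwK : w ≤ K) :
    ∃ m₀ len : ℕ, (len = w ∨ (w ≠ 1 ∧ w ≤ 2 * len)) ∧
      ∀ m, m₀ ≤ m → m < m₀ + len → m < K ∧ ∃ a < w, m = (k + a) % K := by
  by_cases h : k + w ≤ K
  · refine ⟨k, w, Or.inl rfl, fun m h1 h2 => ⟨by omega, m - k, by omega, ?_⟩⟩
    rw [Nat.mod_eq_of_lt (by omega)]
    omega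
  -- A wrapping window splits into two intervals, one of which holds at least half of it. Wrapping
  -- forces w ≥ 2, so nothing is lost when w = 1.
  by_cases h' : w ≤ 2 * (K - k)
  · refine ⟨k, K - k, Or.inr ⟨by omega, h'⟩, fun m h1 h2 => ⟨by omega, m - k, by omega, ?_⟩⟩
    rw [Nat.mod_eq_of_lt (by omega)]
    omega
  · refine ⟨0, w - (K - k), Or.inr ⟨by omega, by omega⟩, fun m h1 h2 =>
      ⟨by omega, K - k + m, by omega, ?_⟩⟩
    rw [show k + (K - k + m) = m + K by omega, Nat.add_mod_right, Nat.mod_eq_of_lt (by omega)]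

/-- The number, before reduction modulo the number of files, of the file that user `u` at cache `m`
requests in the `l`-th broadcast attached to cache `p`. -/
def requestLabel (K t s w b U p m l u : ℕ) : ℕ :=
  ((m * s + (p + (K - m) + (w - 1)) % K / t % s) * b + l) * U + u

theorem exists_add_mod_eq {s e : ℕ} (y : ℕ) (he : e < s) : ∃ j < s, (y + j) % s = e := by
  have hs : 0 < s := by omega
  refine ⟨(e + (s - y % s)) % s, Nat.mod_lt _ hs, ?_⟩
  have hy : y % s < s := Nat.mod_lt _ hs
  rw [Nat.add_mod_mod, Nat.add_mod, Nat.add_mod_eq_ite]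
  have h1 : y % s + (e + (s - y % s)) = e + s := by omega
  rw [← Nat.add_mod_eq_ite, ← Nat.add_mod, ← Nat.mod_add_mod, h1, Nat.add_mod_right,
    Nat.mod_eq_of_lt he]

/-- The summand w - 1 in `requestLabel` keeps the offset from the user's cache to the broadcast's
cache nonnegative, and `hq` keeps it below K, so inside a window it is free of wrap-around. -/
theorem offset_mod_eq {K k a w q : ℕ} (hk : k < K) (ha : a < w) (hq : w - 1 + q < K) :
    ((k + q) % K + (K - (k + a) % K) + (w - 1)) % K = w - 1 - a + q := by
  have hm : (k + a) % K < K := Nat.mod_lt _ (by omega)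
  have h1 : (k + q) % K + (K - (k + a) % K) + (w - 1) ≡ w - 1 - a + q [MOD K] := by
    refine Nat.ModEq.add_right_cancel' ((k + a) % K) ?_
    rw [show (k + q) % K + (K - (k + a) % K) + (w - 1) + (k + a) % K =
      (k + q) % K + (w - 1) + K by omega]
    calc (k + q) % K + (w - 1) + K ≡ (k + q) % K + (w - 1) [MOD K] := by
          simp [Nat.ModEq]
      _ ≡ (k + q) + (w - 1) [MOD K] := (Nat.mod_modEq _ _).add_right _
      _ = w - 1 - a + q + (k + a) := by omega
      _ ≡ w - 1 - a + q + (k + a) % K [MOD K] := (Nat.mod_modEq _ _).symm.add_left _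
  rw [h1, Nat.mod_eq_of_lt (by omega)]

/-- A label has mixed-radix digits m, e, l, u with e = ((w - 1 - a) / t + j) mod s. At a fixed
cache, e takes every residue as j runs over the s groups, wherever the window starts; hence an
interval of caches produces an interval of labels. -/
theorem exists_requestLabel_eq {K t s w b U k m₀ len x : ℕ} (ht : 1 ≤ t)
    (hK : w - 1 + (s - 1) * t < K) (hk : k < K)
    (hint : ∀ m, m₀ ≤ m → m < m₀ + len → m < K ∧ ∃ a < w, m = (k + a) % K)
    (hx : x < len * (s * b * U)) :
    ∃ a < w, ∃ j < s, ∃ l < b, ∃ u < U,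
      requestLabel K t s w b U ((k + j * t) % K) ((k + a) % K) l u = m₀ * (s * b * U) + x := by
  have hpos : 0 < s * b * U := Nat.pos_of_ne_zero fun h => by simp [h] at hx
  have hs : 0 < s := Nat.pos_of_ne_zero fun h => by simp [h] at hpos
  have hb : 0 < b := Nat.pos_of_ne_zero fun h => by simp [h] at hpos
  have hU : 0 < U := Nat.pos_of_ne_zero fun h => by simp [h] at hpos
  obtain ⟨-, a, ha, hma⟩ := hint (m₀ + x / (s * b * U)) (Nat.le_add_right _ _)
    (Nat.add_lt_add_left (Nat.div_lt_of_lt_mul (by rwa [mul_comm])) _)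
  obtain ⟨j, hj, hje⟩ := exists_add_mod_eq ((w - 1 - a) / t) (Nat.mod_lt (x / U / b) hs)
  refine ⟨a, ha, j, hj, x / U % b, Nat.mod_lt _ hb, x % U, Nat.mod_lt _ hU, ?_⟩
  have hjt : j * t ≤ (s - 1) * t := Nat.mul_le_mul_right _ (by omega)
  unfold requestLabel
  rw [offset_mod_eq hk ha (by omega), Nat.add_mul_div_right _ _ (by omega), hje, ← hma]
  have e1 := Nat.div_add_mod x U
  have e2 := Nat.div_add_mod (x / U) b
  have e3 := Nat.div_add_mod (x / U / b) s
  have e4 : x / (s * b * U) = x / U / b / s := by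
    rw [Nat.div_div_eq_div_mul, Nat.div_div_eq_div_mul]
    congr 1
    ring
  have f1 : (m₀ + x / U / b / s) * s + x / U / b % s = m₀ * s + x / U / b := by linarith
  have f2 : (m₀ * s + x / U / b) * b + x / U % b = m₀ * s * b + x / U := by linarith
  have f3 : (m₀ * s * b + x / U) * U + x % U = m₀ * (s * b * U) + x := by linarith
  rw [e4, f1, f2, f3]

variable {L : ℕ} {K : ℕ} {N : Fin L → ℕ}

/-- The requests for the `l`-th broadcast attached to cache `p`. -/
def slidingRequest (hN : ∀ i, 1 ≤ N i) (U d s : Fin L → ℕ) (t b : ℕ) (p : Fin K) (l : Fin b) :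
    Request K N U := fun v =>
  ⟨requestLabel K t (s v.1) (s v.1 * t - d v.1 + 1) b (U v.1) p v.2.1 l v.2.2 % N v.1,
    Nat.mod_lt _ (hN v.1)⟩

open scoped Classical in
/-- The files of level `i` that can be recovered from the caches `k, …, k + s i * t - 1` and the
broadcasts attached to the caches `k, k + t, …, k + (s i - 1) * t`. -/
noncomputable def windowFiles (hN : ∀ i, 1 ≤ N i) (U d s : Fin L → ℕ) (t b : ℕ) (i : Fin L)
    (k : Fin K) : Finset (Fin (N i)) :=
  Finset.univ.filter fun n => ∃ a < s i * t - d i + 1, ∃ j < s i, ∃ l : Fin b, ∃ u : Fin (U i),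
    slidingRequest hN U d s t b (cacheAt k (j * t)) l ⟨i, cacheAt k a, u⟩ = n

theorem min_le_card_windowFiles (hN : ∀ i, 1 ≤ N i) (U d s : Fin L → ℕ) {t b : ℕ} (ht : 1 ≤ t)
    (i : Fin L) (hd : d i ≤ s i * t) (hK : s i * t ≤ K / 2) (hs : 1 ≤ s i) (k : Fin K) :
    (if s i * t = d i then (1 : ℝ) else 1 / 2) *
      min (s i * b * (((s i : ℝ) * t - d i + 1) * U i)) (N i) ≤
        (windowFiles hN U d s t b i k).card := by
  set w := s i * t - d i + 1 with hw
  have hst : (s i - 1) * t + t = s i * t := by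
    rw [← Nat.succ_mul]
    congr 1
    omega
  obtain ⟨m₀, len, hlen, hint⟩ := exists_interval_in_window (w := w) k.isLt (by omega)
  have hcard : min (N i) (len * (s i * b * U i)) ≤ (windowFiles hN U d s t b i k).card := by
    rw [← Finset.card_range (min (N i) (len * (s i * b * U i)))]
    refine Finset.card_le_card_of_injOn
      (fun x => ⟨(m₀ * (s i * b * U i) + x) % N i, Nat.mod_lt _ (hN i)⟩) ?_ ?_
    · intro x hx
      rw [Finset.coe_range, Set.mem_Iio, lt_min_iff] at hx
      obtain ⟨a, ha, j, hj, l, hl, u, hu, h⟩ :=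
        exists_requestLabel_eq ht (by omega) k.isLt hint hx.2
      simp only [windowFiles, Finset.coe_filter, Finset.mem_univ, true_and, Set.mem_ofPred_eq]
      refine ⟨a, ha, j, hj, ⟨l, hl⟩, ⟨u, hu⟩, Fin.ext ?_⟩
      rw [← h]
      rfl
    -- At most `N i` consecutive labels stay distinct modulo `N i`.
    · intro x hx y hy hxy
      rw [Finset.coe_range, Set.mem_Iio, lt_min_iff] at hx hy
      have h1 : m₀ * (s i * b * U i) + x ≡ m₀ * (s i * b * U i) + y [MOD N i] :=
        congrArg Fin.val hxy
      exact (Nat.ModEq.add_left_cancel' _ h1).eq_of_lt_of_lt hx.1 hy.1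
  have hwR : (s i : ℝ) * t - d i + 1 = w := by
    rw [hw]
    push_cast [Nat.cast_sub hd]
    ring
  have hcardR : min (N i : ℝ) (len * (s i * b * U i)) ≤ (windowFiles hN U d s t b i k).card := by
    exact_mod_cast hcard
  refine le_trans ?_ hcardR
  rw [hwR]
  have hP : (0 : ℝ) ≤ s i * b * U i := by positivity
  have hN0 : (0 : ℝ) ≤ N i := Nat.cast_nonneg _
  rcases hlen with hlen | ⟨hw1, hlen⟩
  · have h0 : (0 : ℝ) ≤ min (s i * b * (w * U i) : ℝ) (N i) := by positivity
    have h1 : min (s i * b * (w * U i) : ℝ) (N i) = min (N i : ℝ) (len * (s i * b * U i)) := by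
      rw [min_comm, hlen]
      congr 1
      ring
    rw [← h1]
    split_ifs <;> linarith
  · have hle : (w : ℝ) ≤ 2 * len := by exact_mod_cast hlen
    -- w ≠ 1 says that s_i t ≠ d_i, so the coefficient is 1/2.
    rw [if_neg (by omega)]
    refine le_min ?_ ?_
    · have := min_le_right (s i * b * (w * U i) : ℝ) (N i)
      linarith
    · have h1 := min_le_left (s i * b * (w * U i) : ℝ) (N i)
      have h2 := mul_le_mul_of_nonneg_right hle hP
      linarith

end Requests

/-! ### The entropy bound for a deterministic scheme. -/

section Converse

variable {L K : ℕ} {N U d : Fin L → ℕ} {M R : ℝ} {F : ℕ}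

/-- The libraries for which all users succeed, whatever the requests are. -/
abbrev GoodLibrary (σ : Scheme K N U d M R F) : Type :=
  {W : Library N F // ∀ r, σ.Succeeds r W}

noncomputable instance (σ : Scheme K N U d M R F) : Fintype (GoodLibrary σ) := Fintype.ofFinite _

/-- The random variables of the problem: cache contents, broadcast messages and files. -/
abbrev VarIndex (K : ℕ) (N U : Fin L → ℕ) : Type :=
  Fin K ⊕ Request K N U ⊕ ((i : Fin L) × Fin (N i))

/-- The range of a variable. -/
def VarRange (K : ℕ) (N U : Fin L → ℕ) (M R : ℝ) (F : ℕ) : VarIndex K N U → Type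
  | .inl _ => Content (M * F)
  | .inr (.inl _) => Content (R * F)
  | .inr (.inr _) => Fin F → Bool

/-- The values of the variables, as functions of the library. -/
def schemeVar (σ : Scheme K N U d M R F) :
    (j : VarIndex K N U) → GoodLibrary σ → VarRange K N U M R F j
  | .inl k => fun W => σ.place k W.1
  | .inr (.inl r) => fun W => σ.broadcast r W.1
  | .inr (.inr f) => fun W => W.1 f.1 f.2

theorem log_floor_two_rpow_le {x : ℝ} (h : 0 < ⌊(2 : ℝ) ^ x⌋₊) :
    Real.log ⌊(2 : ℝ) ^ x⌋₊ ≤ x * Real.log 2 := by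
  rw [← Real.log_rpow two_pos]
  exact Real.log_le_log (Nat.cast_pos.2 h) (Nat.floor_le (Real.rpow_pos_of_pos two_pos x).le)

/-- No sign is assumed of x; the element c guarantees that the floor is positive. -/
theorem log_card_content_le {x : ℝ} (c : Content x) :
    Real.log (Fintype.card (Content x)) ≤ x * Real.log 2 := by
  rw [Fintype.card_fin]
  exact log_floor_two_rpow_le c.pos

theorem jointEntropy_cache_le (σ : Scheme K N U d M R F) [h : Nonempty (GoodLibrary σ)]
    (k : Fin K) : jointEntropy (schemeVar σ) {.inl k} ≤ M * F * Real.log 2 := by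
  let _ : Fintype (VarRange K N U M R F (.inl k)) := (inferInstance : Fintype (Content (M * F)))
  exact (jointEntropy_singleton_le (schemeVar σ) (.inl k)).trans
    (log_card_content_le (σ.place k h.some.1))

theorem jointEntropy_broadcast_le (σ : Scheme K N U d M R F) [h : Nonempty (GoodLibrary σ)]
    (r : Request K N U) : jointEntropy (schemeVar σ) {.inr (.inl r)} ≤ R * F * Real.log 2 := by
  let _ : Fintype (VarRange K N U M R F (.inr (.inl r))) :=
    (inferInstance : Fintype (Content (R * F)))
  exact (jointEntropy_singleton_le (schemeVar σ) (.inr (.inl r))).trans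
    (log_card_content_le (σ.broadcast r h.some.1))

theorem jointEntropy_file_le (σ : Scheme K N U d M R F) [Nonempty (GoodLibrary σ)]
    (f : (i : Fin L) × Fin (N i)) :
    jointEntropy (schemeVar σ) {.inr (.inr f)} ≤ F * Real.log 2 := by
  let _ : Fintype (VarRange K N U M R F (.inr (.inr f))) :=
    (inferInstance : Fintype (Fin F → Bool))
  refine (jointEntropy_singleton_le (schemeVar σ) (.inr (.inr f))).trans (le_of_eq ?_)
  have : Fintype.card (VarRange K N U M R F (.inr (.inr f))) = 2 ^ F :=
    (Fintype.card_fun (α := Fin F) (β := Bool)).trans (by simp)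
  rw [this]
  simp

/-- The variables that are files in `D`. -/
def fileVars (K : ℕ) (N U : Fin L → ℕ) (D : Finset ((i : Fin L) × Fin (N i))) :
    Set (VarIndex K N U) :=
  {j | ∃ f ∈ D, j = .inr (.inr f)}

theorem fileVars_union [DecidableEq ((i : Fin L) × Fin (N i))]
    (D D' : Finset ((i : Fin L) × Fin (N i))) :
    fileVars K N U (D ∪ D') = fileVars K N U D ∪ fileVars K N U D' := by
  ext j
  simp only [fileVars, Set.mem_ofPred_eq, Set.mem_union, Finset.mem_union, or_and_right, exists_or]

theorem fileVars_mono {D D' : Finset ((i : Fin L) × Fin (N i))} (h : D ⊆ D') :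
    fileVars K N U D ⊆ fileVars K N U D' := by
  rintro j ⟨f, hf, rfl⟩
  exact ⟨f, h hf, rfl⟩

theorem jointEntropy_fileVars_le (σ : Scheme K N U d M R F) [Nonempty (GoodLibrary σ)]
    (D : Finset ((i : Fin L) × Fin (N i))) :
    jointEntropy (schemeVar σ) (fileVars K N U D) ≤ D.card * (F * Real.log 2) := by
  have h : fileVars K N U D = ⋃ f ∈ D, {.inr (.inr f)} := by
    ext j
    simp [fileVars]
  rw [h]
  refine (jointEntropy_biUnion_le _ _ _).trans
    ((Finset.sum_le_sum fun f _ => jointEntropy_file_le σ f).trans ?_)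
  simp

theorem log_card_library : Real.log (Fintype.card (Library N F)) =
    Fintype.card ((i : Fin L) × Fin (N i)) * (F * Real.log 2) := by
  have : Fintype.card (Library N F) = 2 ^ (F * ∑ i, N i) := by
    simp [Library, Fintype.card_pi, Finset.prod_pow_eq_pow_sum, ← pow_mul, Finset.mul_sum]
  rw [this]
  simp
  ring

/-- All files together determine the good library, whose entropy is within log 2 of the maximum; the
files outside D account for at most F log 2 each. -/
theorem le_jointEntropy_fileVars (σ : Scheme K N U d M R F) [Nonempty (GoodLibrary σ)]
    (hσ : Fintype.card (Library N F) ≤ 2 * Fintype.card (GoodLibrary σ))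
    (D : Finset ((i : Fin L) × Fin (N i))) :
    Fintype.card ((i : Fin L) × Fin (N i)) * (F * Real.log 2) - Real.log 2 ≤
      jointEntropy (schemeVar σ) (fileVars K N U D) +
        (Fintype.card ((i : Fin L) × Fin (N i)) - D.card) * (F * Real.log 2) := by
  classical
  have hall : jointEntropy (schemeVar σ) (fileVars K N U Finset.univ) =
      Real.log (Fintype.card (GoodLibrary σ)) := by
    refine jointEntropy_eq_log_card _ fun W W' h => Subtype.ext ?_
    funext i n
    exact h (.inr (.inr ⟨i, n⟩)) ⟨⟨i, n⟩, Finset.mem_univ _, rfl⟩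
  have hlog : Real.log (Fintype.card (Library N F)) ≤
      Real.log 2 + Real.log (Fintype.card (GoodLibrary σ)) := by
    rw [← Real.log_mul two_ne_zero (Nat.cast_ne_zero.2 Fintype.card_ne_zero)]
    exact Real.log_le_log (Nat.cast_pos.2 Fintype.card_pos) (by exact_mod_cast hσ)
  have hun : jointEntropy (schemeVar σ) (fileVars K N U Finset.univ) ≤
      jointEntropy (schemeVar σ) (fileVars K N U D) +
        jointEntropy (schemeVar σ) (fileVars K N U Dᶜ) := by
    rw [← Finset.union_compl D, fileVars_union]
    exact jointEntropy_union_le _ _ _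
  have hc := jointEntropy_fileVars_le σ (K := K) (U := U) Dᶜ
  rw [Finset.card_compl, Nat.cast_sub (Finset.card_le_univ D)] at hc
  rw [log_card_library] at hlog
  linarith

theorem le_jointEntropy_union_sub (σ : Scheme K N U d M R F) [Nonempty (GoodLibrary σ)]
    (hσ : Fintype.card (Library N F) ≤ 2 * Fintype.card (GoodLibrary σ))
    {E D : Finset ((i : Fin L) × Fin (N i))} (hED : Disjoint E D) :
    D.card * (F * Real.log 2) - Real.log 2 ≤
      jointEntropy (schemeVar σ) (fileVars K N U E ∪ fileVars K N U D) -
        jointEntropy (schemeVar σ) (fileVars K N U E) := by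
  classical
  have h1 := le_jointEntropy_fileVars σ hσ (E ∪ D)
  have h2 := jointEntropy_fileVars_le σ (K := K) (U := U) E
  rw [fileVars_union, Finset.card_union_of_disjoint hED] at h1
  push_cast at h1
  linarith

/-- The `t` consecutive caches from cache `k` on, and the broadcasts attached to cache `k`. -/
def windowVars (hN : ∀ i, 1 ≤ N i) (U d s : Fin L → ℕ) (t b : ℕ) (k : Fin K) :
    Set (VarIndex K N U) :=
  (⋃ j ∈ Finset.range t, {.inl (cacheAt k j)}) ∪
    ⋃ l ∈ (Finset.univ : Finset (Fin b)), {.inr (.inl (slidingRequest hN U d s t b k l))}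

theorem jointEntropy_windowVars_le (σ : Scheme K N U d M R F) [Nonempty (GoodLibrary σ)]
    (hN : ∀ i, 1 ≤ N i) (s : Fin L → ℕ) (t b : ℕ) (k : Fin K) :
    jointEntropy (schemeVar σ) (windowVars hN U d s t b k) ≤
      (t * M + b * R) * F * Real.log 2 := by
  have h1 : jointEntropy (schemeVar σ) (⋃ j ∈ Finset.range t, {.inl (cacheAt k j)}) ≤
      ∑ _j ∈ Finset.range t, M * F * Real.log 2 :=
    (jointEntropy_biUnion_le _ _ _).trans (Finset.sum_le_sum fun j _ => jointEntropy_cache_le σ _)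
  have h2 : jointEntropy (schemeVar σ) (⋃ l ∈ (Finset.univ : Finset (Fin b)),
      {.inr (.inl (slidingRequest hN U d s t b k l))}) ≤
      ∑ _l : Fin b, R * F * Real.log 2 :=
    (jointEntropy_biUnion_le _ _ _).trans
      (Finset.sum_le_sum fun l _ => jointEntropy_broadcast_le σ _)
  rw [Finset.sum_const, nsmul_eq_mul, Finset.card_range] at h1
  rw [Finset.sum_const, nsmul_eq_mul, Finset.card_univ, Fintype.card_fin] at h2
  refine (jointEntropy_union_le _ _ _).trans ((add_le_add h1 h2).trans (le_of_eq ?_))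
  ring

/-- A user at k + a with a ≤ s_i t - d_i reads only caches of the window, and on good libraries
decoding never fails. -/
theorem windowVars_determine (σ : Scheme K N U d M R F) (hN : ∀ i, 1 ≤ N i) {s : Fin L → ℕ}
    {t b : ℕ} (ht : 1 ≤ t) {i : Fin L} (hd : d i ≤ s i * t) (k : Fin K) (W W' : GoodLibrary σ)
    (h : ∀ v ∈ ⋃ j ∈ Finset.range (s i), windowVars hN U d s t b ((rotate K t)^[j] k),
      schemeVar σ v W' = schemeVar σ v W) {n : Fin (N i)}
    (hn : n ∈ windowFiles hN U d s t b i k) : W'.1 i n = W.1 i n := by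
  simp only [Set.mem_iUnion, Finset.mem_range, rotate_iterate] at h
  have hcache : ∀ x < s i * t, σ.place (cacheAt k x) W'.1 = σ.place (cacheAt k x) W.1 := by
    intro x hx
    refine h (.inl (cacheAt k x)) ⟨x / t, Nat.div_lt_of_lt_mul (by rwa [mul_comm]), Or.inl ?_⟩
    simp only [Set.mem_iUnion, Finset.mem_range, Set.mem_singleton_iff]
    refine ⟨x % t, Nat.mod_lt _ ht, ?_⟩
    rw [cacheAt_cacheAt, Nat.div_add_mod']
  simp only [windowFiles, Finset.mem_filter, Finset.mem_univ, true_and] at hn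
  obtain ⟨a, ha, j, hj, l, u, rfl⟩ := hn
  set r := slidingRequest hN U d s t b (cacheAt k (j * t)) l
  have hbc : σ.broadcast r W'.1 = σ.broadcast r W.1 := by
    refine h (.inr (.inl r)) ⟨j, hj, Or.inr ?_⟩
    simp only [Set.mem_iUnion, Set.mem_singleton_iff]
    exact ⟨l, Finset.mem_univ _, rfl⟩
  have e1 := W.2 r ⟨i, cacheAt k a, u⟩
  have e2 := W'.2 r ⟨i, cacheAt k a, u⟩
  rw [← e1, ← e2, hbc]
  congr 1
  funext x
  simp only [cacheAt_cacheAt]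
  exact hcache _ (by have := x.isLt; simp only at this; omega)

theorem windowEntropy_level_le (σ : Scheme K N U d M R F) [Nonempty (GoodLibrary σ)]
    (hσ : Fintype.card (Library N F) ≤ 2 * Fintype.card (GoodLibrary σ))
    (hN : ∀ i, 1 ≤ N i) {s : Fin L → ℕ} {t b : ℕ} (ht : 1 ≤ t) {i : Fin L}
    (hd : d i ≤ s i * t) {T : Finset (Fin L)} (hi : i ∉ T) {c : ℝ}
    (hc : ∀ k : Fin K, c ≤ (windowFiles hN U d s t b i k).card) :
    K * ((c * F - 1) * Real.log 2) +
      windowEntropy (schemeVar σ) (windowVars hN U d s t b) (rotate K t)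
        (fileVars K N U ((insert i T).sigma fun _ => Finset.univ)) (s i) ≤
      windowEntropy (schemeVar σ) (windowVars hN U d s t b) (rotate K t)
        (fileVars K N U (T.sigma fun _ => Finset.univ)) (s i) := by
  have hK : (K : ℝ) * ((c * F - 1) * Real.log 2) =
      ∑ _k : Fin K, (c * F - 1) * Real.log 2 := by simp
  unfold windowEntropy
  rw [hK, ← Finset.sum_add_distrib]
  refine Finset.sum_le_sum fun k _ => ?_
  have hdisj : Disjoint (T.sigma fun i => (Finset.univ : Finset (Fin (N i))))
      (({i} : Finset (Fin L)).sigma fun i => windowFiles hN U d s t b i k) := by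
    rw [Finset.disjoint_left]
    rintro ⟨i', n⟩ h1 h2
    rw [Finset.mem_sigma] at h1 h2
    exact hi (Finset.mem_singleton.1 h2.1 ▸ h1.1)
  have h1 := le_jointEntropy_union_sub σ hσ hdisj
  rw [Finset.card_sigma, Finset.sum_singleton] at h1
  have h2 := mul_le_mul_of_nonneg_right (hc k)
    (mul_nonneg (Nat.cast_nonneg F) (Real.log_nonneg one_le_two))
  have h3 := jointEntropy_sub_le_of_determines (schemeVar σ)
    (S := ⋃ j ∈ Finset.range (s i), windowVars hN U d s t b ((rotate K t)^[j] k))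
    (D := fileVars K N U (({i} : Finset (Fin L)).sigma fun i => windowFiles hN U d s t b i k))
    (E := fileVars K N U (T.sigma fun _ => Finset.univ))
    (E' := fileVars K N U ((insert i T).sigma fun _ => Finset.univ))
    (fileVars_mono (Finset.sigma_mono (Finset.subset_insert i T) fun _ => subset_rfl))
    (fileVars_mono (Finset.sigma_mono (Finset.singleton_subset_iff.2 (Finset.mem_insert_self i T))
      fun _ => Finset.subset_univ _))
    (by
      rintro W W' h v ⟨⟨i', n⟩, hf, rfl⟩
      obtain ⟨hi', hn⟩ := Finset.mem_sigma.1 hf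
      obtain rfl := Finset.mem_singleton.1 hi'
      exact windowVars_determine σ hN ht hd k W W' h hn)
  linarith

/-- Level i is collected at window length s_i, hence the weight 1 / s_i; each level loses one bit to
the restriction to good libraries. -/
theorem sum_div_le_of_card_le (σ : Scheme K N U d M R F)
    (hσ : Fintype.card (Library N F) ≤ 2 * Fintype.card (GoodLibrary σ))
    (hN : ∀ i, 1 ≤ N i) {s : Fin L → ℕ} (hs : ∀ i, 1 ≤ s i) {t b : ℕ} (ht : 1 ≤ t) (hK : 1 ≤ K)
    (hd : ∀ i, d i ≤ s i * t) {c : Fin L → ℝ}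
    (hc : ∀ i, ∀ k : Fin K, c i ≤ (windowFiles hN U d s t b i k).card) :
    ∑ i, (c i * F - 1) / s i ≤ (t * M + b * R) * F := by
  have hcard : 0 < Fintype.card (Library N F) := Fintype.card_pos
  have : Nonempty (GoodLibrary σ) := Fintype.card_pos_iff.1 (by omega)
  set g : Finset (Fin L) → ℕ → ℝ := fun T n =>
    windowEntropy (schemeVar σ) (windowVars hN U d s t b) (rotate K t)
      (fileVars K N U (T.sigma fun _ => Finset.univ)) n with hg
  have hlog : 0 < Real.log 2 := Real.log_pos one_lt_two
  have hKR : (0 : ℝ) < K := Nat.cast_pos.2 (by omega)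
  have hfirst : g ∅ 1 ≤ K * ((t * M + b * R) * F * Real.log 2) := by
    have : g ∅ 1 = ∑ k : Fin K, jointEntropy (schemeVar σ) (windowVars hN U d s t b k) := by
      simp [hg, windowEntropy, fileVars, jointEntropy_empty]
    rw [this]
    refine (Finset.sum_le_sum fun k _ => jointEntropy_windowVars_le σ hN s t b k).trans ?_
    simp
  have key : ∀ T : Finset (Fin L), ∀ n, 1 ≤ n → (∀ i ∈ T, s i ≤ n) →
      ∑ i ∈ T, K * ((c i * F - 1) * Real.log 2) / s i + g T n / n ≤ g ∅ 1 := by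
    intro T
    -- Inserting the largest s_i last keeps the window lengths increasing, as the monotonicity of
    -- the normalized entropy requires.
    induction T using Finset.induction_on_max_value s with
    | empty =>
      intro n hn _
      have := windowEntropy_div_antitone (schemeVar σ) (windowVars hN U d s t b) (rotate K t)
        (fileVars K N U ((∅ : Finset (Fin L)).sigma fun _ => Finset.univ)) le_rfl hn
      rw [Nat.cast_one, div_one] at this
      rw [Finset.sum_empty, zero_add]
      exact this
    | insert i T hi hmax ih =>
      intro n hn hle
      rw [Finset.sum_insert hi]
      have h1 := ih (s i) (hs i) hmax
      have h2 := windowEntropy_div_antitone (schemeVar σ) (windowVars hN U d s t b) (rotate K t)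
        (fileVars K N U ((insert i T).sigma fun _ => Finset.univ)) (hs i)
        (hle i (Finset.mem_insert_self i T))
      have h3 := div_le_div_of_nonneg_right
        (windowEntropy_level_le σ hσ hN ht (hd i) hi (hc i)) (Nat.cast_nonneg (s i))
      rw [add_div] at h3
      simp only [hg] at h1 ⊢
      linarith
  obtain ⟨n, hn1, hn⟩ : ∃ n, 1 ≤ n ∧ ∀ i, s i ≤ n :=
    ⟨∑ i, s i + 1, by omega, fun i =>
      (Finset.single_le_sum (fun _ _ => Nat.zero_le _) (Finset.mem_univ i)).trans (by omega)⟩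
  have h1 := key Finset.univ n hn1 fun i _ => hn i
  have h2 : 0 ≤ g Finset.univ n / n := by
    refine div_nonneg (Finset.sum_nonneg fun k _ => sub_nonneg.2 ?_) (Nat.cast_nonneg _)
    exact jointEntropy_mono _ Set.subset_union_right
  have h3 : ∑ i, K * ((c i * F - 1) * Real.log 2) / s i =
      K * Real.log 2 * ∑ i, (c i * F - 1) / s i := by
    rw [Finset.mul_sum]
    exact Finset.sum_congr rfl fun i _ => by ring
  refine le_of_mul_le_mul_left ?_ (mul_pos hKR hlog)
  linarith

end Converse

/-! ### From strategies to one scheme, and existence of an achievable rate. -/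

section Randomization

variable {L K : ℕ} {N U d : Fin L → ℕ} {M R : ℝ} {F : ℕ}

theorem half_le_sum_of_card_lt (σ : Scheme K N U d M R F)
    (h : 2 * Fintype.card (GoodLibrary σ) < Fintype.card (Library N F)) :
    2⁻¹ ≤ ∑ r, (PMF.uniformOfFintype (Library N F)).toOuterMeasure {W | ¬ σ.Succeeds r W} := by
  classical
  have hunion : (⋃ r, {W | ¬ σ.Succeeds r W}) = {W : Library N F | ¬ ∀ r, σ.Succeeds r W} := by
    ext W
    simp
  have hle := MeasureTheory.measure_iUnion_le (μ := (PMF.uniformOfFintype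
    (Library N F)).toOuterMeasure) fun r => {W | ¬ σ.Succeeds r W}
  rw [tsum_fintype, hunion] at hle
  refine le_trans ?_ hle
  rw [PMF.toOuterMeasure_uniformOfFintype_apply]
  have hcard : Fintype.card {W : Library N F | ¬ ∀ r, σ.Succeeds r W} =
      Fintype.card (Library N F) - Fintype.card (GoodLibrary σ) := by
    rw [← Fintype.card_subtype_compl]
    exact Fintype.card_congr (Equiv.refl _)
  have h0 : (Fintype.card (Library N F) : ℝ≥0∞) ≠ 0 := Nat.cast_ne_zero.2 (by omega)
  rw [ENNReal.le_div_iff_mul_le (Or.inl h0) (Or.inl (ENNReal.natCast_ne_top _)), hcard,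
    mul_comm, ← div_eq_mul_inv]
  refine ENNReal.div_le_of_le_mul ?_
  exact_mod_cast (by omega : Fintype.card (Library N F) ≤
    (Fintype.card (Library N F) - Fintype.card (GoodLibrary σ)) * 2)

/-- A strategy with small error probability contains a scheme that succeeds for all requests on at
least half of the libraries. -/
theorem exists_scheme_of_errorProb_le (P : Strategy K N U d M R F) {ε : ℝ≥0∞}
    (h : ∀ r, errorProb P r ≤ ε) (hε : Fintype.card (Request K N U) * ε < 2⁻¹) :
    ∃ σ : Scheme K N U d M R F,
      Fintype.card (Library N F) ≤ 2 * Fintype.card (GoodLibrary σ) := by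
  by_contra! hσ
  refine hε.not_ge ?_
  calc (2⁻¹ : ℝ≥0∞) = ∑' σ, P σ * 2⁻¹ := by rw [ENNReal.tsum_mul_right, P.tsum_coe, one_mul]
    _ ≤ ∑' σ, ∑ r, P σ *
          (PMF.uniformOfFintype (Library N F)).toOuterMeasure {W | ¬ σ.Succeeds r W} := by
        refine ENNReal.tsum_le_tsum fun σ => ?_
        rw [← Finset.mul_sum]
        gcongr
        exact half_le_sum_of_card_lt σ (hσ σ)
    _ = ∑ r, errorProb P r := Summable.tsum_finsetSum fun _ _ => ENNReal.summable
    _ ≤ Fintype.card (Request K N U) * ε := by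
        refine (Finset.sum_le_sum fun r _ => h r).trans ?_
        simp

/-- Any pair at which the whole library can be broadcast is achievable. -/
theorem achievable_of_sum_le (K : ℕ) (N U d : Fin L → ℕ) {M : ℝ} (hM : 0 ≤ M) :
    Achievable K N U d (∑ i, N i : ℕ) M := by
  have hcard : ∀ F : ℕ, Nonempty (Library N F ≃ Content (((∑ i, N i : ℕ) : ℝ) * F)) := by
    intro F
    refine Fintype.card_eq.1 ?_
    have h1 : Fintype.card (Library N F) = 2 ^ (F * ∑ i, N i) := by
      simp [Library, Fintype.card_pi, Finset.prod_pow_eq_pow_sum, ← pow_mul, Finset.mul_sum]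
    rw [h1, Fintype.card_fin, ← Nat.cast_mul, Real.rpow_natCast, mul_comm]
    exact_mod_cast (Nat.floor_natCast (R := ℝ) (2 ^ ((∑ i, N i) * F))).symm
  -- M ≥ 0 makes the cache alphabet nonempty, so that a constant placement exists.
  have hpos : ∀ F : ℕ, 0 < ⌊(2 : ℝ) ^ (M * F)⌋₊ := fun F =>
    Nat.floor_pos.2 (Real.one_le_rpow one_le_two (mul_nonneg hM (Nat.cast_nonneg F)))
  let σ : (F : ℕ) → Scheme K N U d M (∑ i, N i : ℕ) F := fun F =>
    { place := fun _ _ => ⟨0, hpos F⟩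
      broadcast := fun _ W => (hcard F).some W
      decode := fun r v _ x => (hcard F).some.symm x v.1 (r v) }
  have hσ : ∀ F r W, (σ F).Succeeds r W := by
    intro F r W v
    simp [σ]
  refine ⟨fun F => PMF.pure (σ F), ?_⟩
  have h0 : ∀ F r, errorProb (PMF.pure (σ F)) r = 0 := by
    intro F r
    refine ENNReal.tsum_eq_zero.2 fun τ => ?_
    by_cases hτ : τ = σ F
    · subst hτ
      simp [hσ]
    · simp [PMF.pure_apply, hτ]
  simp [h0]

end Randomization

end MultiLevelCaching

/-! ### The limit of large files. -/

theorem mainTheorem2 {L : ℕ} (K : ℕ) (N U d : Fin L → ℕ) (hN : ∀ i, 1 ≤ N i)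
    (b t : ℕ) (hb : 1 ≤ b) (ht : t ∈ Set.Icc 1 K)
    (s : Fin L → ℕ) (hs : ∀ i, 1 ≤ s i) (hst : ∀ i, s i * t ∈ Set.Icc (d i) (K / 2))
    (M : ℝ) (hM : 0 ≤ M) :
    ∑ i : Fin L, (if s i * t = d i then (1 : ℝ) else 1 / 2) *
        min (((s i : ℝ) * t - d i + 1) * U i) ((N i : ℝ) / (s i * b)) - (t : ℝ) / b * M
      ≤ MultiLevelCaching.optimalRate K N U d M := by
  open MultiLevelCaching in
  -- The real infimum of an empty set would be 0, so some achievable rate has to be exhibited.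
  refine le_csInf ⟨_, achievable_of_sum_le K N U d hM⟩ ?_
  rintro R ⟨P, hP⟩
  set c : Fin L → ℝ := fun i => (if s i * t = d i then (1 : ℝ) else 1 / 2) *
    min (s i * b * (((s i : ℝ) * t - d i + 1) * U i)) (N i) with hc
  have hbR : (0 : ℝ) < b := Nat.cast_pos.2 (by omega)
  have hsR : ∀ i, (0 : ℝ) < s i := fun i => Nat.cast_pos.2 (hs i)
  have hev : ∀ᶠ F : ℕ in Filter.atTop,
      ∑ i, c i / s i - (∑ i, 1 / (s i : ℝ)) / F ≤ t * M + b * R := by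
    -- With n request vectors, n / (4(n + 1)) < 1/2, as the averaging argument needs.
    have hε : (0 : ℝ≥0∞) < (4 * ((Fintype.card (Request K N U) : ℝ≥0∞) + 1))⁻¹ :=
      ENNReal.inv_pos.2 (by finiteness)
    filter_upwards [hP.eventually (Iic_mem_nhds hε), Filter.eventually_gt_atTop 0] with F hF hF0
    obtain ⟨σ, hσ⟩ := exists_scheme_of_errorProb_le (P F)
      (fun r => (le_iSup (fun r => errorProb (P F) r) r).trans hF) (by
        rw [← div_eq_mul_inv]
        refine ENNReal.div_lt_of_lt_mul ?_
        rw [← mul_assoc, show (2⁻¹ : ℝ≥0∞) * 4 = 2 by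
          rw [show (4 : ℝ≥0∞) = 2 * 2 by norm_num, ← mul_assoc,
            ENNReal.inv_mul_cancel two_ne_zero ENNReal.ofNat_ne_top, one_mul]]
        exact_mod_cast (by omega : Fintype.card (Request K N U) <
          2 * (Fintype.card (Request K N U) + 1)))
    have h := sum_div_le_of_card_le σ hσ hN hs ht.1 (ht.1.trans ht.2) (fun i => (hst i).1)
      (b := b) fun i k => min_le_card_windowFiles hN U d s ht.1 i (hst i).1 (hst i).2 (hs i) k
    have hFR : (0 : ℝ) < F := Nat.cast_pos.2 hF0
    rw [← div_le_iff₀ hFR] at h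
    refine le_trans (le_of_eq ?_) h
    rw [Finset.sum_div, Finset.sum_div, ← Finset.sum_sub_distrib]
    refine Finset.sum_congr rfl fun i _ => ?_
    have := hsR i
    simp only [hc]
    field_simp
  have hlim : Filter.Tendsto (fun F : ℕ => ∑ i, c i / s i - (∑ i, 1 / (s i : ℝ)) / F)
      Filter.atTop (𝓝 (∑ i, c i / s i)) := by
    simpa using tendsto_const_nhds.sub
      (tendsto_const_div_atTop_nhds_zero_nat (∑ i, 1 / (s i : ℝ)))
  have hmain := le_of_tendsto hlim hev
  have hsum : ∑ i : Fin L, (if s i * t = d i then (1 : ℝ) else 1 / 2) *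
      min (((s i : ℝ) * t - d i + 1) * U i) ((N i : ℝ) / (s i * b)) = (∑ i, c i / s i) / b := by
    rw [Finset.sum_div]
    refine Finset.sum_congr rfl fun i _ => ?_
    have hsb : (0 : ℝ) < s i * b := mul_pos (hsR i) hbR
    rw [div_div, eq_div_iff hsb.ne', mul_assoc, min_mul_of_nonneg _ _ hsb.le,
      div_mul_cancel₀ _ hsb.ne', mul_comm _ ((s i : ℝ) * b)]
  rw [hsum, div_mul_eq_mul_div, ← sub_div, div_le_iff₀ hbR]
  linarith
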